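/- **Theorem 4.2.** Let $n\ge 1$, let $\mathbb F_n^+$ be the free semigroup on generators $g_1,\dots,g_n$ with neutral element $g_0$, and let $\mu=\{\mu_\beta\}_{\beta\in\mathbb F_n^+}$ be strictly positive real numbers with $\mu_{g_0}=1$ and $\sup\{\mu_{g_i\alpha}:\alpha\in\mathbb F_n^+,\ 1\le i\le n\}<\infty$. For $\alpha=g_{i_1}\cdots g_{i_k}$ put $\mu(\alpha,g_0)=\mu_{g_{i_1}\cdots g_{i_k}}\mu_{g_{i_2}\cdots g_{i_k}}\cdots\mu_{g_{i_k}}$, $\mu(g_0,g_0)=1$, and $|\alpha|=k$; for an $n$-tuple $X=(X_1,\dots,X_n)$ of complex numbers or of operators put $X_\alpha=X_{i_1}\cdots X_{i_k}$, with $X_{g_0}$ the identity. Let $F^2(\mu)$ be the Hilbert space of formal power series $f=\sum_\alpha c_\alpha Z_\alpha$ ($c_\alpha\in\mathbb C$) in noncommuting indeterminates $Z_1,\dots,Z_n$ with $\|f\|_\mu^2=\sum_\alpha\mu(\alpha,g_0)^2|c_\alpha|^2<\infty$, let $L_{Z_i}f=Z_if$ on $F^2(\mu)$ and $L_Z=(L_{Z_1},\dots,L_{Z_n})$.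 For a tuple $X$ of bounded operators on a Hilbert space write $\|X\|=\|X_1X_1^*+\dots+X_nX_n^*\|^{1/2}$. Let $\mathcal D(\mu)$ be the set of bounded point evaluations, i.e. of those $\lambda\in\mathbb C^n$ for which there is $C>0$ with $|p(\lambda)|\le C\|p\|_\mu$ for all $p\in\mathbb C\langle Z_1,\dots,Z_n\rangle$; then $\varphi_\lambda$ denotes the bounded linear functional on $F^2(\mu)$ that extends $p\mapsto p(\lambda)$. The joint point spectrum $\sigma_p(T_1,\dots,T_n)$ is the set of $\zeta\in\mathbb C^n$ for which there is $z\ne0$ with $T_iz=\zeta_iz$ for all $i$. 1. $$\mathcal D(\mu)=\Big\{\lambda\in\mathbb C^n:\ \sum_{\alpha\in\mathbb F_n^+}\frac{|\lambda_\alpha|^2}{\mu(\alpha,g_0)^2}<\infty\Big\}=\sigma_p(L_{Z_1}^*,\dots,L_{Z_n}^*).$$ 2. If $\lambda\in\mathcal D(\mu)$, then the bounded extension $\varphi_\lambda$ exists and is unique, and for every $f=\sum_\alpha c_\alpha Z_\alpha\in F^2(\mu)$ the series $f(\lambda):=\sum_\alpha c_\alpha\lambda_\alpha$ converges absolutely to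 $\varphi_\lambda(f)$, with $$|f(\lambda)|\le\|f\|_\mu\Big(\sum_{\alpha}\frac{|\lambda_\alpha|^2}{\mu(\alpha,g_0)^2}\Big)^{1/2}.$$ 3. If $\lambda\in\mathbb C^n$ and $\sum_{k=0}^\infty\sum_{|\alpha|=k}c_\alpha\lambda_\alpha$ converges for every $f=\sum_\alpha c_\alpha Z_\alpha\in F^2(\mu)$, then $\lambda\in\mathcal D(\mu)$. 4. Let $\mathcal H$ be an infinite-dimensional complex Hilbert space and let $\varphi=\sum_\alpha c_\alpha Z_\alpha$ be a bounded free holomorphic function on the open ball $\{X\in B(\mathcal H)^n:\|X\|<\|L_Z\|\}$, i.e. $\varphi(X)=\sum_{k=0}^\infty\sum_{|\alpha|=k}c_\alpha X_\alpha$ converges in norm for every $X$ in the ball and $\|\varphi(X)\|$ is bounded there. Then $\varphi$ is a left multiplier of $F^2(\mu)$, i.e. the product of formal power series $\varphi\zeta$ is in $F^2(\mu)$ for every $\zeta\in F^2(\mu)$; the operator $L_\varphi\zeta=\varphi\zeta$ is bounded; there is a unique bounded operator $\varphi(L_{Z_1},\dots,L_{Z_n})$ on $F^2(\mu)$ that sends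 every polynomial $p$ to $\sum_\alpha c_\alpha (L_Z)_\alpha p$ (a convergent series in $F^2(\mu)$); and $$\|L_\varphi\|=\|\varphi(L_{Z_1},\dots,L_{Z_n})\|\le\sup\{\|\varphi(X_1,\dots,X_n)\|:\ X\in B(\mathcal H)^n,\ \|X\|<\|L_Z\|\}.$$ -/

import Mathlib

open Filter Topology

namespace WeightedFock

/-- The free semigroup on the `n` generators `g_1, …, g_n`, with neutral element `g_0 = 1`. -/
abbrev Word (n : ℕ) : Type := FreeMonoid (Fin n)

instance (n : ℕ) : DecidableEq (Word n) := inferInstanceAs (DecidableEq (List (Fin n)))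

/-- Formal power series `∑ c_α Z_α` in `n` noncommuting indeterminates, given by coefficients. -/
abbrev Series (n : ℕ) : Type := Word n → ℂ

/-- Noncommutative polynomials `ℂ⟨Z_1, …, Z_n⟩`. -/
abbrev NCPoly (n : ℕ) : Type := MonoidAlgebra ℂ (Word n)

/-- The finite set of words of length `k`. -/
def words (n k : ℕ) : Finset (Word n) :=
  Finset.univ.image fun v : Fin k → Fin n => FreeMonoid.ofList (List.ofFn v)

theorem mem_words {n k : ℕ} {α : Word n} : α ∈ words n k ↔ α.length = k := by
  simp only [words, Finset.mem_image, Finset.mem_univ, true_and]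
  constructor
  · rintro ⟨v, rfl⟩
    exact List.length_ofFn
  · rintro rfl
    exact ⟨fun i => α.toList.get i, List.ofFn_get α.toList⟩

/-- The partial sums `∑_{k < N} ∑_{|α| = k} c_α x_α` of a series grouped by word length. -/
noncomputable def partialSum {n : ℕ} {E : Type*} [AddCommGroup E] [Module ℂ E]
    (c : Series n) (x : Word n → E) (N : ℕ) : E :=
  ∑ k ∈ Finset.range N, ∑ α ∈ words n k, c α • x α

/-- The finite set of factorizations `γ = α β` of a word. -/
def splits {n : ℕ} (γ : Word n) : Finset (Word n × Word n) :=
  (Finset.range (γ.length + 1)).image fun k =>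
    (FreeMonoid.ofList (γ.toList.take k), FreeMonoid.ofList (γ.toList.drop k))

theorem mem_splits {n : ℕ} {γ : Word n} {p : Word n × Word n} :
    p ∈ splits γ ↔ p.1 * p.2 = γ := by
  simp only [splits, Finset.mem_image, Finset.mem_range]
  constructor
  · rintro ⟨k, -, rfl⟩
    exact List.take_append_drop k γ.toList
  · rintro rfl
    refine ⟨p.1.length, ?_, ?_⟩
    · rw [FreeMonoid.length_mul]; omega
    · exact Prod.ext (List.take_left (l₁ := p.1.toList) (l₂ := p.2.toList))
        (List.drop_left (l₁ := p.1.toList) (l₂ := p.2.toList))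

/-- The product of formal power series: the coefficient of `Z_γ` is `∑_{αβ = γ} a_α d_β`. -/
noncomputable def mulSeries {n : ℕ} (a d : Series n) : Series n :=
  fun γ => ∑ p ∈ splits γ, a p.1 * d p.2

/-- The monomial `Z_α` as a formal power series. -/
def monomial {n : ℕ} (α : Word n) : Series n := Pi.single α 1

theorem mulSeries_gen_one {n : ℕ} (i : Fin n) (d : Series n) :
    mulSeries (monomial (FreeMonoid.of i)) d 1 = 0 := by
  refine Finset.sum_eq_zero fun p hp => ?_
  have h := mem_splits.1 hp
  have h1 : p.1 ≠ FreeMonoid.of i := by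
    intro h2
    have := congrArg FreeMonoid.length h
    rw [FreeMonoid.length_mul, h2, FreeMonoid.length_of, FreeMonoid.length_one] at this
    omega
  simp [monomial, h1]

theorem mulSeries_gen_of_mul {n : ℕ} (i j : Fin n) (d : Series n) (γ : Word n) :
    mulSeries (monomial (FreeMonoid.of i)) d (FreeMonoid.of j * γ) = if j = i then d γ else 0 := by
  have key : ∀ p ∈ splits (FreeMonoid.of j * γ), p.1 = FreeMonoid.of i → j = i ∧ p.2 = γ := by
    intro p hp h
    have h2 := mem_splits.1 hp
    rw [h] at h2
    have h3 : i :: p.2.toList = j :: γ.toList := h2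
    injection h3 with h4 h5
    exact ⟨h4.symm, h5⟩
  unfold mulSeries
  split_ifs with hji
  · subst hji
    rw [Finset.sum_eq_single (FreeMonoid.of j, γ)]
    · simp [monomial]
    · intro p hp hne
      have : p.1 ≠ FreeMonoid.of j := fun h => hne (Prod.ext h (key p hp h).2)
      simp [monomial, this]
    · intro h
      exact absurd ((mem_splits (p := (FreeMonoid.of j, γ))).2 rfl) h
  · refine Finset.sum_eq_zero fun p hp => ?_
    have : p.1 ≠ FreeMonoid.of i := fun h => hji (key p hp h).1
    simp [monomial, this]

/-- A sequence of strictly positive weights `μ_β` with `μ_{g_0} = 1` and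
`sup_{α, i} μ_{g_i α} < ∞`. -/
structure Weights (n : ℕ) where
  μ : Word n → ℝ
  pos : ∀ β, 0 < μ β
  one : μ 1 = 1
  bdd : BddAbove (Set.range fun p : Fin n × Word n => μ (FreeMonoid.of p.1 * p.2))

variable {n : ℕ} (w : Weights n)

/-- `μ_{g_{i_1} ⋯ g_{i_k}} μ_{g_{i_2} ⋯ g_{i_k}} ⋯ μ_{g_{i_k}}` for the list `i_1, …, i_k`. -/
def Weights.listNorm : List (Fin n) → ℝ
  | [] => 1
  | i :: l => w.μ (FreeMonoid.ofList (i :: l)) * Weights.listNorm l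

/-- The number `μ(α, g_0)`, which is the norm of `Z_α`. -/
def Weights.mon (α : Word n) : ℝ := w.listNorm α.toList

theorem Weights.mon_one : w.mon 1 = 1 := rfl

theorem Weights.mon_of_mul (i : Fin n) (α : Word n) :
    w.mon (FreeMonoid.of i * α) = w.μ (FreeMonoid.of i * α) * w.mon α := rfl

theorem Weights.mon_pos (α : Word n) : 0 < w.mon α := by
  induction α using FreeMonoid.inductionOn' with
  | one => rw [w.mon_one]; exact one_pos
  | of_mul i α ih => rw [w.mon_of_mul]; exact mul_pos (w.pos _) ih

theorem memlp_iff (c : Series n) :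
    Memℓp (fun α => (w.mon α : ℂ) * c α) 2 ↔ Summable fun α => w.mon α ^ 2 * ‖c α‖ ^ 2 := by
  rw [memℓp_gen_iff (by norm_num)]
  refine summable_congr fun α => ?_
  simp [mul_pow]

/-- The formal power series `∑ c_α Z_α` with `∑ μ(α, g_0)² |c_α|² < ∞`. -/
def hardySubmodule : Submodule ℂ (Series n) where
  carrier := {c | Summable fun α => w.mon α ^ 2 * ‖c α‖ ^ 2}
  add_mem' {a b} ha hb := by
    have h := ((memlp_iff w a).2 ha).add ((memlp_iff w b).2 hb)
    refine (memlp_iff w (a + b)).1 ?_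
    convert h using 1
    ext α
    simp [mul_add]
  zero_mem' := by simp [summable_zero]
  smul_mem' r a ha := by
    have h := ((memlp_iff w a).2 ha).const_smul r
    refine (memlp_iff w (r • a)).1 ?_
    convert h using 1
    ext α
    simp [mul_left_comm]

theorem mem_hardySubmodule (c : Series n) :
    c ∈ hardySubmodule w ↔ Summable fun α => w.mon α ^ 2 * ‖c α‖ ^ 2 := Iff.rfl

/-- The Hilbert space `F²(μ)`. -/
def F2 : Type := hardySubmodule w

noncomputable section

instance : AddCommGroup (F2 w) := inferInstanceAs (AddCommGroup (hardySubmodule w))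
instance : Module ℂ (F2 w) := inferInstanceAs (Module ℂ (hardySubmodule w))

variable {w}

/-- The formal power series underlying an element of `F²(μ)`; `f.series α` is its coefficient
at `Z_α`. -/
def F2.series (f : F2 w) : Series n := Subtype.val (p := fun c => c ∈ hardySubmodule w) f

theorem F2.summable (f : F2 w) : Summable fun α => w.mon α ^ 2 * ‖f.series α‖ ^ 2 :=
  Subtype.property (p := fun c => c ∈ hardySubmodule w) f

/-- The element of `F²(μ)` given by a formal power series in `F²(μ)`. -/
def F2.mk (c : Series n) (hc : c ∈ hardySubmodule w) : F2 w := ⟨c, hc⟩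

@[simp] theorem F2.series_mk (c : Series n) (hc : c ∈ hardySubmodule w) :
    (F2.mk c hc).series = c := rfl

@[ext] theorem F2.ext {f g : F2 w} (h : f.series = g.series) : f = g := Subtype.ext h

@[simp] theorem F2.series_add (f g : F2 w) : (f + g).series = f.series + g.series := rfl
@[simp] theorem F2.series_smul (r : ℂ) (f : F2 w) : (r • f).series = r • f.series := rfl
@[simp] theorem F2.series_zero : (0 : F2 w).series = 0 := rfl

variable (w)

/-- The linear bijection `f ↦ (μ(α, g_0) c_α)_α` from `F²(μ)` onto `ℓ²`. -/
def toL2 : F2 w ≃ₗ[ℂ] lp (fun _ : Word n => ℂ) 2 where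
  toFun f := ⟨fun α => (w.mon α : ℂ) * f.series α, (memlp_iff w _).2 f.summable⟩
  map_add' f g := by
    ext α
    exact mul_add _ _ _
  map_smul' r f := by
    ext α
    exact mul_left_comm _ _ _
  invFun x := F2.mk (fun α => (w.mon α : ℂ)⁻¹ * x α) <| (mem_hardySubmodule w _).2 <| (memlp_iff w _).1 <| by
    convert lp.memℓp x using 1
    ext α
    have : (w.mon α : ℂ) ≠ 0 := by exact_mod_cast (w.mon_pos α).ne'
    field_simp
  left_inv f := by
    ext α
    have : (w.mon α : ℂ) ≠ 0 := by exact_mod_cast (w.mon_pos α).ne'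
    simp [this]
  right_inv x := by
    ext α
    have : (w.mon α : ℂ) ≠ 0 := by exact_mod_cast (w.mon_pos α).ne'
    simp [this]

theorem toL2_apply (f : F2 w) (α : Word n) : toL2 w f α = (w.mon α : ℂ) * f.series α := rfl

theorem inner_toL2 (f g : F2 w) : inner ℂ (toL2 w f) (toL2 w g) =
    ∑' α, (w.mon α : ℂ) ^ 2 * (starRingEnd ℂ (f.series α) * g.series α) := by
  rw [lp.inner_eq_tsum]
  refine tsum_congr fun α => ?_
  simp only [toL2_apply, RCLike.inner_apply, map_mul, Complex.conj_ofReal]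
  ring

/-- The inner product `⟨f, g⟩ = ∑ μ(α, g_0)² conj(f_α) g_α` of `F²(μ)` (conjugate linear in the
first variable, as everywhere in Mathlib). -/
@[reducible] def F2.core : InnerProductSpace.Core ℂ (F2 w) where
  inner f g := ∑' α, (w.mon α : ℂ) ^ 2 * (starRingEnd ℂ (f.series α) * g.series α)
  conj_inner_symm f g := by simp only [← inner_toL2]; exact inner_conj_symm _ _
  re_inner_nonneg f := by simp only [← inner_toL2]; exact inner_self_nonneg
  add_left f g h := by simp only [← inner_toL2, map_add]; exact inner_add_left _ _ _
  smul_left f g r := by simp only [← inner_toL2, map_smul]; exact inner_smul_left _ _ _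
  definite f hf := by
    simp only [← inner_toL2] at hf
    exact (toL2 w).map_eq_zero_iff.1 (inner_self_eq_zero.1 hf)

instance : NormedAddCommGroup (F2 w) := (F2.core w).toNormedAddCommGroup
instance : InnerProductSpace ℂ (F2 w) := InnerProductSpace.ofCore (F2.core w).toCore

theorem F2.inner_def (f g : F2 w) : inner ℂ f g =
    ∑' α, (w.mon α : ℂ) ^ 2 * (starRingEnd ℂ (f.series α) * g.series α) := rfl

theorem norm_toL2 (f : F2 w) : ‖toL2 w f‖ = ‖f‖ := by
  rw [@norm_eq_sqrt_re_inner ℂ, @norm_eq_sqrt_re_inner ℂ _ _ _ _ f, inner_toL2, F2.inner_def]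

theorem F2.norm_sq (f : F2 w) : ‖f‖ ^ 2 = ∑' α, w.mon α ^ 2 * ‖f.series α‖ ^ 2 := by
  have h := lp.norm_rpow_eq_tsum (p := 2) (by norm_num) (toL2 w f)
  rw [norm_toL2] at h
  simpa [toL2_apply, mul_pow] using h

/-- The map `toL2` as a unitary operator. -/
def toL2Isometry : F2 w ≃ₗᵢ[ℂ] lp (fun _ : Word n => ℂ) 2 := ⟨toL2 w, norm_toL2 w⟩

instance : CompleteSpace (F2 w) :=
  (toL2Isometry w).isometry.isUniformInducing.completeSpace_congr
    (toL2Isometry w).surjective |>.2 inferInstance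

/-- Noncommutative polynomials as elements of `F²(μ)`. -/
def ofPoly (p : NCPoly n) : F2 w :=
  F2.mk (fun α => p.coeff α) <| (mem_hardySubmodule w _).2 <| summable_of_ne_finset_zero (s := p.coeff.support) <| by
    intro α hα
    simp [Finsupp.notMem_support_iff.1 hα]

theorem hasSum_shift (i : Fin n) (f : F2 w) :
    HasSum (fun γ => w.mon γ ^ 2 * ‖mulSeries (monomial (FreeMonoid.of i)) f.series γ‖ ^ 2)
      (∑' α, w.mon (FreeMonoid.of i * α) ^ 2 * ‖f.series α‖ ^ 2) := by
  obtain ⟨C, hC⟩ := w.bdd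
  have hs : Summable fun α => w.mon (FreeMonoid.of i * α) ^ 2 * ‖f.series α‖ ^ 2 := by
    refine Summable.of_nonneg_of_le (fun α => by positivity) (fun α => ?_)
      (f.summable.mul_left (C ^ 2))
    rw [w.mon_of_mul, mul_pow, mul_assoc]
    have h1 : w.μ (FreeMonoid.of i * α) ≤ C := hC ⟨(i, α), rfl⟩
    have h2 := (w.pos (FreeMonoid.of i * α)).le
    gcongr
  have hinj : Function.Injective fun α : Word n => FreeMonoid.of i * α := fun α β h =>
    mul_left_cancel h
  refine (hinj.hasSum_iff ?_).1 ?_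
  · intro γ hγ
    induction γ using FreeMonoid.casesOn with
    | one => simp [mulSeries_gen_one]
    | of_mul j γ =>
      have : j ≠ i := by
        rintro rfl
        exact hγ ⟨γ, rfl⟩
      simp [mulSeries_gen_of_mul, this]
  · convert hs.hasSum using 2 with α
    simp [mulSeries_gen_of_mul]

/-- The left multiplication operator `L_{Z_i} ζ = Z_i ζ` on `F²(μ)`. -/
def LZ (i : Fin n) : F2 w →L[ℂ] F2 w :=
  LinearMap.mkContinuousOfExistsBound
    { toFun := fun f => F2.mk (mulSeries (monomial (FreeMonoid.of i)) f.series)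
        ((mem_hardySubmodule w _).2 (hasSum_shift w i f).summable)
      map_add' := fun f g => by
        ext γ; simp [mulSeries, mul_add, Finset.sum_add_distrib]
      map_smul' := fun r f => by
        ext γ; simp [mulSeries, Finset.mul_sum, mul_left_comm] } <| by
    obtain ⟨C, hC⟩ := w.bdd
    have hC0 : 0 ≤ C := (w.pos _).le.trans (hC ⟨(i, 1), rfl⟩)
    refine ⟨C, fun f => ?_⟩
    refine le_of_sq_le_sq ?_ (by positivity)
    rw [mul_pow, F2.norm_sq, F2.norm_sq, ← tsum_mul_left]
    refine ((hasSum_shift w i f).tsum_eq).trans_le ?_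
    have hle : ∀ α, w.mon (FreeMonoid.of i * α) ^ 2 * ‖f.series α‖ ^ 2 ≤
        C ^ 2 * (w.mon α ^ 2 * ‖f.series α‖ ^ 2) := by
      intro α
      rw [w.mon_of_mul, mul_pow, mul_assoc]
      have h1 : w.μ (FreeMonoid.of i * α) ≤ C := hC ⟨(i, α), rfl⟩
      have h2 := (w.pos (FreeMonoid.of i * α)).le
      gcongr
    exact (Summable.of_nonneg_of_le (fun α => by positivity) hle
      (f.summable.mul_left (C ^ 2))).tsum_le_tsum hle (f.summable.mul_left (C ^ 2))

theorem LZ_series (i : Fin n) (f : F2 w) :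
    (LZ w i f).series = mulSeries (monomial (FreeMonoid.of i)) f.series := rfl

/-- The evaluation `φ_λ(p) = p(λ)` of polynomials at a point of `ℂⁿ`. Here `FreeMonoid.lift z` is
the map `α ↦ λ_α = λ_{i_1} ⋯ λ_{i_k}` for `α = g_{i_1} ⋯ g_{i_k}`. -/
def evalPoly (z : Fin n → ℂ) (p : NCPoly n) : ℂ :=
  MonoidAlgebra.lift ℂ ℂ (Word n) (FreeMonoid.lift z) p

/-- The set `𝓓(μ)` of bounded point evaluations on `F²(μ)`. -/
def boundedPointEvals : Set (Fin n → ℂ) :=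
  {z | ∃ C : ℝ, 0 < C ∧ ∀ p : NCPoly n, ‖evalPoly z p‖ ≤ C * ‖ofPoly w p‖}

/-- A bounded linear functional on `F²(μ)` that extends `φ_λ`. -/
def ExtendsEval (z : Fin n → ℂ) (ℓ : F2 w →L[ℂ] ℂ) : Prop :=
  ∀ p : NCPoly n, ℓ (ofPoly w p) = evalPoly z p

/-- The joint point spectrum of a tuple of operators: the set of tuples of joint eigenvalues. -/
def jointPointSpectrum {H : Type*} [NormedAddCommGroup H] [InnerProductSpace ℂ H]
    (T : Fin n → H →L[ℂ] H) : Set (Fin n → ℂ) :=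
  {z | ∃ x : H, x ≠ 0 ∧ ∀ i, T i x = z i • x}

/-- The norm `‖(X_1, …, X_n)‖ = ‖X_1 X_1^* + ⋯ + X_n X_n^*‖^{1/2}` of a row of operators. -/
def rowNorm {H : Type*} [NormedAddCommGroup H] [InnerProductSpace ℂ H] [CompleteSpace H]
    (X : Fin n → H →L[ℂ] H) : ℝ :=
  √‖∑ i, X i * ContinuousLinearMap.adjoint (X i)‖

/-- The open ball of radius `r` in `B(H)ⁿ`. -/
def opBall (n : ℕ) (H : Type*) [NormedAddCommGroup H] [InnerProductSpace ℂ H] [CompleteSpace H]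
    (r : ℝ) : Set (Fin n → H →L[ℂ] H) :=
  {X | rowNorm X < r}

/-- The formal power series `φ` is a free holomorphic function on the open ball of radius `r` of
`B(H)ⁿ`: the series `∑_k ∑_{|α| = k} c_α X_α` converges in norm at every point of the ball. -/
def IsFreeHolomorphic (H : Type*) [NormedAddCommGroup H] [InnerProductSpace ℂ H] [CompleteSpace H]
    (r : ℝ) (φ : Series n) : Prop :=
  ∀ X ∈ opBall n H r, ∃ Y : H →L[ℂ] H,
    Tendsto (partialSum φ fun α => FreeMonoid.lift X α) atTop (𝓝 Y)

/-- The value `φ(X) = ∑_k ∑_{|α| = k} c_α X_α` of a free holomorphic function. -/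
def evalOp {H : Type*} [NormedAddCommGroup H] [InnerProductSpace ℂ H]
    (φ : Series n) (X : Fin n → H →L[ℂ] H) : H →L[ℂ] H :=
  limUnder atTop (partialSum φ fun α => FreeMonoid.lift X α)

/-- `φ` is a bounded free holomorphic function on the open ball of radius `r` of `B(H)ⁿ`. -/
def IsBoundedFreeHolomorphic (H : Type*) [NormedAddCommGroup H] [InnerProductSpace ℂ H]
    [CompleteSpace H] (r : ℝ) (φ : Series n) : Prop :=
  IsFreeHolomorphic H r φ ∧ ∃ M : ℝ, ∀ X ∈ opBall n H r, ‖evalOp φ X‖ ≤ M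

/-- `φ` is a left multiplier of `F²(μ)`: the product `φ ζ` is in `F²(μ)` for all `ζ` in `F²(μ)`. -/
def IsLeftMultiplier (φ : Series n) : Prop :=
  ∀ ζ : F2 w, mulSeries φ ζ.series ∈ hardySubmodule w

/-- `A` is the operator `φ(L_{Z_1}, …, L_{Z_n})`: the bounded operator on `F²(μ)` that extends
`p ↦ ∑ c_α (L_Z)_α p`, with `p` ranging over the polynomials. -/
def IsSeriesOfShift (φ : Series n) (A : F2 w →L[ℂ] F2 w) : Prop :=
  ∀ p : NCPoly n, HasSum (fun α => φ α • (FreeMonoid.lift (LZ w) α) (ofPoly w p)) (A (ofPoly w p))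

end

end WeightedFock

open WeightedFock

namespace WeightedFock

noncomputable section

variable {n : ℕ} (w : Weights n)

/-! The monomials `Z_α` form an orthogonal basis of `F²(μ)` with `‖Z_α‖ = μ(α, g_0)`. Evaluation at
`λ` can therefore only be the pairing with `k_λ = ∑ conj(λ_α) μ(α, g_0)⁻² Z_α`, whose squared norm
is the series in the theorem; testing boundedness on truncations of `k_λ` shows that this series
must converge (`kernelSummable_of_mem`). Since `L_{Z_i} Z_α = Z_{g_i α}`, a joint eigenvector of the
adjoints is determined by its constant term, and the same series decides whether it exists
(`jointPointSpectrum_eq`). Part 3 is Banach–Steinhaus.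

For part 4, an isometry `V : F²(μ) → H` carries `r L_Z` to the tuple `r V L_{Z_i} V*`, which lies in
the open ball for `0 < r < 1`. Compressing the value of `φ` there by `V` gives multiplication by the
series with coefficients `c_α r^|α|`, of norm at most the supremum (`exists_dilated_multiplier`).
Each coefficient of a product is a finite sum, so finite parts of the norm survive `r → 1`
(`sum_mulSeries_le`): `L_φ` is bounded with the same bound. It agrees with `φ(L_Z)` on monomials, so
the two operators coincide. -/

theorem Weights.mon_ne_zero (α : Word n) : (w.mon α : ℂ) ≠ 0 := by
  exact_mod_cast (w.mon_pos α).ne'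

/-! ### Monomials as an orthogonal basis of `F²(μ)` -/

/-- The monomial `Z_α` as an element of `F²(μ)`. -/
def F2.Z (α : Word n) : F2 w := ofPoly w (MonoidAlgebra.single α 1)

@[simp] theorem ofPoly_series (p : NCPoly n) : (ofPoly w p).series = fun α => p.coeff α := rfl

theorem F2.Z_series (α : Word n) : (F2.Z w α).series = monomial α := by
  ext β
  simp [F2.Z, monomial, Finsupp.single_apply, Pi.single_apply, eq_comm]

theorem ofPoly_add (p q : NCPoly n) : ofPoly w (p + q) = ofPoly w p + ofPoly w q := by
  ext α; simp

theorem ofPoly_smul (r : ℂ) (p : NCPoly n) : ofPoly w (r • p) = r • ofPoly w p := by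
  ext α; simp

theorem ofPoly_single (α : Word n) (r : ℂ) :
    ofPoly w (MonoidAlgebra.single α r) = r • F2.Z w α := by
  rw [F2.Z, ← ofPoly_smul]; simp

theorem ofPoly_zero : ofPoly w 0 = 0 := by
  ext α; simp

theorem F2.inner_Z (α : Word n) (f : F2 w) :
    inner ℂ (F2.Z w α) f = (w.mon α : ℂ) ^ 2 * f.series α := by
  rw [F2.inner_def, tsum_eq_single α]
  · simp [F2.Z_series, monomial]
  · intro β hβ
    simp [F2.Z_series, monomial, hβ]

theorem F2.hasSum_inner (f g : F2 w) :
    HasSum (fun α => (w.mon α : ℂ) ^ 2 * (starRingEnd ℂ (f.series α) * g.series α))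
      (inner ℂ f g) := by
  have h := lp.hasSum_inner (𝕜 := ℂ) (toL2 w f) (toL2 w g)
  rw [inner_toL2, ← F2.inner_def] at h
  have e : (fun α => (w.mon α : ℂ) ^ 2 * (starRingEnd ℂ (f.series α) * g.series α)) =
      fun α => inner ℂ (toL2 w f α) (toL2 w g α) := by
    funext α
    simp only [toL2_apply, RCLike.inner_apply, map_mul, Complex.conj_ofReal]
    ring
  rwa [e]

theorem F2.ext_inner_Z {f g : F2 w}
    (h : ∀ α, inner ℂ (F2.Z w α) f = inner ℂ (F2.Z w α) g) : f = g := by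
  ext α
  have := h α
  rw [F2.inner_Z, F2.inner_Z] at this
  exact mul_left_cancel₀ (pow_ne_zero 2 (w.mon_ne_zero α)) this

/-- The bounded functional `f ↦ c_α` on `F²(μ)`. -/
def F2.coeffL (α : Word n) : F2 w →L[ℂ] ℂ := ((w.mon α : ℂ) ^ 2)⁻¹ • innerSL ℂ (F2.Z w α)

@[simp] theorem F2.coeffL_apply (α : Word n) (f : F2 w) : F2.coeffL w α f = f.series α := by
  have := w.mon_ne_zero α
  simp [F2.coeffL, F2.inner_Z, this]

/-- The expansion in the standard basis of `ℓ²`, carried back by the unitary `toL2Isometry`. -/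
theorem F2.hasSum_Z (f : F2 w) : HasSum (fun α => f.series α • F2.Z w α) f := by
  have h := lp.hasSum_single (p := 2) (by norm_num) (toL2 w f)
  have h2 := h.mapL (toL2Isometry w).symm.toContinuousLinearEquiv.toContinuousLinearMap
  have e : (toL2Isometry w).symm.toContinuousLinearEquiv.toContinuousLinearMap (toL2 w f) = f :=
    (toL2 w).symm_apply_apply f
  rw [e] at h2
  convert h2 using 2 with α
  apply (toL2 w).injective
  refine Eq.trans ?_ ((toL2 w).apply_symm_apply _).symm
  ext β
  by_cases hβ : β = α
  · subst hβ
    simp [toL2_apply, F2.Z_series, monomial, mul_comm]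
  · simp [toL2_apply, F2.Z_series, monomial, hβ]

theorem F2.clm_ext {E : Type*} [NormedAddCommGroup E] [NormedSpace ℂ E] {A B : F2 w →L[ℂ] E}
    (h : ∀ α, A (F2.Z w α) = B (F2.Z w α)) : A = B := by
  ext1 f
  have hA := (F2.hasSum_Z w f).mapL A
  have hB := (F2.hasSum_Z w f).mapL B
  simp only [map_smul, h] at hA hB
  exact hA.unique hB

/-! ### Bounded point evaluations and the reproducing kernel -/

theorem evalPoly_add (z : Fin n → ℂ) (p q : NCPoly n) :
    evalPoly z (p + q) = evalPoly z p + evalPoly z q := map_add _ _ _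

theorem evalPoly_single (z : Fin n → ℂ) (α : Word n) (r : ℂ) :
    evalPoly z (MonoidAlgebra.single α r) = r * FreeMonoid.lift z α := by
  simp [evalPoly]

theorem extendsEval_iff (z : Fin n → ℂ) (l : F2 w →L[ℂ] ℂ) :
    ExtendsEval w z l ↔ ∀ α, l (F2.Z w α) = FreeMonoid.lift z α := by
  constructor
  · intro h α
    rw [F2.Z, h, evalPoly_single, one_mul]
  · intro h p
    induction p using MonoidAlgebra.induction_linear with
    | zero => simp [ofPoly_zero, evalPoly]
    | add p q hp hq => rw [ofPoly_add, map_add, hp, hq, evalPoly_add]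
    | single α r => rw [ofPoly_single, map_smul, h, evalPoly_single, smul_eq_mul]

/-- The square-summability condition `∑ |λ_α|² / μ(α, g_0)² < ∞`. -/
def KernelSummable (z : Fin n → ℂ) : Prop :=
  Summable fun α : Word n => ‖FreeMonoid.lift z α‖ ^ 2 / w.mon α ^ 2

theorem mon_sq_mul_norm_sq (a : ℂ) (α : Word n) :
    w.mon α ^ 2 * ‖a / (w.mon α : ℂ) ^ 2‖ ^ 2 = ‖a‖ ^ 2 / w.mon α ^ 2 := by
  have := (w.mon_pos α).ne'
  have h2 := (w.mon_pos α).le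
  simp only [norm_div, norm_pow, Complex.norm_real, Real.norm_eq_abs, abs_of_nonneg h2]
  field_simp

variable {w}

/-- The reproducing kernel `∑ conj(λ_α) μ(α, g_0)⁻² Z_α` at `λ`. -/
def kernelVec {z : Fin n → ℂ} (hz : KernelSummable w z) : F2 w :=
  F2.mk (fun α => starRingEnd ℂ (FreeMonoid.lift z α) / (w.mon α : ℂ) ^ 2) <| by
    rw [mem_hardySubmodule]
    simpa only [mon_sq_mul_norm_sq, RCLike.norm_conj] using (show Summable _ from hz)

theorem norm_kernelVec {z : Fin n → ℂ} (hz : KernelSummable w z) :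
    ‖kernelVec hz‖ = √(∑' α : Word n, ‖FreeMonoid.lift z α‖ ^ 2 / w.mon α ^ 2) := by
  rw [eq_comm, Real.sqrt_eq_iff_mul_self_eq (tsum_nonneg fun α => by positivity) (norm_nonneg _),
    ← sq, F2.norm_sq]
  simp only [kernelVec, F2.series_mk, mon_sq_mul_norm_sq, RCLike.norm_conj]

theorem kernelVec_term {z : Fin n → ℂ} (hz : KernelSummable w z) (f : F2 w) (α : Word n) :
    (w.mon α : ℂ) ^ 2 * (starRingEnd ℂ ((kernelVec hz).series α) * f.series α) =
      f.series α * FreeMonoid.lift z α := by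
  have := w.mon_ne_zero α
  simp only [kernelVec, F2.series_mk, map_div₀, map_pow, Complex.conj_ofReal, Complex.conj_conj]
  field_simp

theorem hasSum_kernel {z : Fin n → ℂ} (hz : KernelSummable w z) (f : F2 w) :
    HasSum (fun α => f.series α * FreeMonoid.lift z α) (innerSL ℂ (kernelVec hz) f) := by
  simpa only [kernelVec_term, innerSL_apply_apply] using F2.hasSum_inner w (kernelVec hz) f

theorem extendsEval_kernel {z : Fin n → ℂ} (hz : KernelSummable w z) :
    ExtendsEval w z (innerSL ℂ (kernelVec hz)) := by
  rw [extendsEval_iff]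
  intro α
  refine (hasSum_kernel hz _).unique ?_
  convert hasSum_single α ?_ using 1
  · simp [F2.Z_series, monomial]
  · intro β hβ
    simp [F2.Z_series, monomial, hβ]

variable (w)

/-- The truncation `p` of the kernel to a finite set `s` satisfies `p(λ) = ‖p‖² = S`, with `S` the
partial sum over `s`. Hence `‖p‖² ≤ C ‖p‖`, so `S ≤ C²` uniformly in `s`. -/
theorem kernelSummable_of_mem {z : Fin n → ℂ} (hz : z ∈ boundedPointEvals w) :
    KernelSummable w z := by
  obtain ⟨C, hC, h⟩ := hz
  refine summable_of_sum_le (c := C ^ 2) (fun α => by positivity) fun s => ?_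
  set S := ∑ α ∈ s, ‖FreeMonoid.lift z α‖ ^ 2 / w.mon α ^ 2
  have hS : 0 ≤ S := Finset.sum_nonneg fun α _ => by positivity
  let p : NCPoly n := ∑ α ∈ s,
    MonoidAlgebra.single α (starRingEnd ℂ (FreeMonoid.lift z α) / (w.mon α : ℂ) ^ 2)
  have hp : ∀ β, p.coeff β =
      if β ∈ s then starRingEnd ℂ (FreeMonoid.lift z β) / (w.mon β : ℂ) ^ 2 else 0 := by
    intro β
    simp [p, MonoidAlgebra.coeff_sum, Finsupp.finsetSum_apply, Finsupp.single_apply]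
  have h1 : evalPoly z p = (S : ℂ) := by
    simp only [p, S, evalPoly, map_sum, MonoidAlgebra.lift_single, smul_eq_mul]
    push_cast
    refine Finset.sum_congr rfl fun α _ => ?_
    rw [div_mul_eq_mul_div, ← Complex.conj_mul']
  have h2 : ‖ofPoly w p‖ ^ 2 = S := by
    rw [F2.norm_sq, tsum_eq_sum (s := s)]
    · refine Finset.sum_congr rfl fun α hα => ?_
      simp only [ofPoly_series, hp, if_pos hα, mon_sq_mul_norm_sq, RCLike.norm_conj]
    · intro α hα
      simp [hp, hα]
  have h3 := h p
  rw [h1, Complex.norm_real, Real.norm_eq_abs, abs_of_nonneg hS, ← h2] at h3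
  have h4 : ‖ofPoly w p‖ ≤ C := by
    by_contra! hlt
    nlinarith
  rw [← h2]
  gcongr

theorem mem_of_extendsEval {z : Fin n → ℂ} {l : F2 w →L[ℂ] ℂ} (hl : ExtendsEval w z l) :
    z ∈ boundedPointEvals w := by
  -- The constant must be strictly positive, and `‖l‖` is not known to be.
  refine ⟨‖l‖ + 1, by positivity, fun p => ?_⟩
  rw [← hl p]
  refine (l.le_opNorm _).trans ?_
  gcongr
  linarith

theorem boundedPointEvals_eq : boundedPointEvals w = {z | KernelSummable w z} :=
  Set.Subset.antisymm (fun _ hz => kernelSummable_of_mem w hz)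
    fun _ hz => mem_of_extendsEval w (extendsEval_kernel hz)

/-! ### Joint eigenvectors of the adjoint shifts -/

theorem LZ_Z (i : Fin n) (α : Word n) : LZ w i (F2.Z w α) = F2.Z w (FreeMonoid.of i * α) := by
  ext γ
  rw [LZ_series, F2.Z_series, F2.Z_series]
  induction γ using FreeMonoid.casesOn with
  | one =>
    rw [mulSeries_gen_one]
    have : (1 : Word n) ≠ FreeMonoid.of i * α := by
      intro h
      have := congrArg FreeMonoid.length h
      rw [FreeMonoid.length_mul, FreeMonoid.length_of, FreeMonoid.length_one] at this
      omega
    simp [monomial, this]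
  | of_mul j γ =>
    rw [mulSeries_gen_of_mul]
    have : FreeMonoid.of j * γ = FreeMonoid.of i * α ↔ j = i ∧ γ = α := by
      constructor
      · intro h
        have h3 : j :: γ.toList = i :: α.toList := h
        injection h3 with h4 h5
        exact ⟨h4, h5⟩
      · rintro ⟨rfl, rfl⟩; rfl
    simp only [monomial, Pi.single_apply, this]
    split_ifs <;> simp_all

/-- If `x` is an eigenvector, `⟨Z_{g_i α}, x⟩ = ⟨Z_α, L_{Z_i}* x⟩ = λ_i ⟨Z_α, x⟩`. By induction
`⟨Z_α, x⟩ = λ_α x_1`, so `x` is a multiple of `∑ λ_α μ(α, g_0)⁻² Z_α`; conversely this vector is an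
eigenvector whenever it lies in `F²(μ)`. -/
theorem jointPointSpectrum_eq :
    {z | KernelSummable w z} =
      jointPointSpectrum fun i => ContinuousLinearMap.adjoint (LZ w i) := by
  ext z
  constructor
  · intro hz
    have hmem : (fun α => FreeMonoid.lift z α / (w.mon α : ℂ) ^ 2) ∈ hardySubmodule w := by
      rw [mem_hardySubmodule]
      simpa only [mon_sq_mul_norm_sq] using (show Summable _ from hz)
    refine ⟨F2.mk _ hmem, ?_, fun i => F2.ext_inner_Z w fun α => ?_⟩
    · intro h
      have := congrFun (congrArg F2.series h) 1
      simp [w.mon_one] at this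
    · have h1 := w.mon_ne_zero α
      have h2 := w.mon_ne_zero (FreeMonoid.of i * α)
      rw [ContinuousLinearMap.adjoint_inner_right, LZ_Z, inner_smul_right, F2.inner_Z, F2.inner_Z]
      simp only [F2.series_mk, map_mul, FreeMonoid.lift_eval_of]
      field_simp
  · rintro ⟨x, hx, h⟩
    have key : ∀ α, inner ℂ (F2.Z w α) x = FreeMonoid.lift z α * x.series 1 := by
      intro α
      induction α using FreeMonoid.inductionOn' with
      | one => simp [F2.inner_Z, w.mon_one]
      | of_mul i α ih =>
        rw [← LZ_Z, ← ContinuousLinearMap.adjoint_inner_right, h i, inner_smul_right, ih,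
          map_mul, FreeMonoid.lift_eval_of, mul_assoc]
    have hser : ∀ α, x.series α = FreeMonoid.lift z α * x.series 1 / (w.mon α : ℂ) ^ 2 := by
      intro α
      rw [← key, F2.inner_Z, mul_div_cancel_left₀ _ (pow_ne_zero 2 (w.mon_ne_zero α))]
    have h1 : x.series 1 ≠ 0 := by
      intro h0
      apply hx
      ext α
      rw [hser, h0]
      simp
    have hs := x.summable.mul_left ((‖x.series 1‖ ^ 2)⁻¹)
    have h2 : ‖x.series 1‖ ≠ 0 := norm_ne_zero_iff.2 h1
    refine hs.congr fun α => ?_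
    rw [hser α, mon_sq_mul_norm_sq, norm_mul, mul_pow]
    field_simp

theorem exists_unique_extension {z : Fin n → ℂ} (hz : z ∈ boundedPointEvals w) :
    ∃ ℓ : F2 w →L[ℂ] ℂ,
      (∀ ℓ' : F2 w →L[ℂ] ℂ, ExtendsEval w z ℓ' ↔ ℓ' = ℓ) ∧
      ∀ f : F2 w,
        (Summable fun α => ‖f.series α * FreeMonoid.lift z α‖) ∧
        HasSum (fun α => f.series α * FreeMonoid.lift z α) (ℓ f) ∧
        ‖∑' α, f.series α * FreeMonoid.lift z α‖ ≤
          ‖f‖ * √(∑' α : Word n, ‖FreeMonoid.lift z α‖ ^ 2 / w.mon α ^ 2) := by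
  have hk := kernelSummable_of_mem w hz
  refine ⟨innerSL ℂ (kernelVec hk), fun l => ⟨fun h => ?_, ?_⟩, fun f =>
    ⟨(hasSum_kernel hk f).summable.norm, hasSum_kernel hk f, ?_⟩⟩
  · refine F2.clm_ext w fun α => ?_
    rw [(extendsEval_iff w z _).1 h, (extendsEval_iff w z _).1 (extendsEval_kernel hk)]
  · rintro rfl
    exact extendsEval_kernel hk
  · rw [(hasSum_kernel hk f).tsum_eq, ← norm_kernelVec hk, mul_comm]
    exact norm_inner_le_norm (𝕜 := ℂ) (kernelVec hk) f

/-! ### Pointwise convergence and Banach–Steinhaus -/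

/-- The partial sums `∑_{|α| < N} c_α λ_α` as bounded functionals of `f = ∑ c_α Z_α`. -/
def partialEval (z : Fin n → ℂ) (N : ℕ) : F2 w →L[ℂ] ℂ :=
  ∑ k ∈ Finset.range N, ∑ α ∈ words n k, FreeMonoid.lift z α • F2.coeffL w α

theorem partialEval_apply (z : Fin n → ℂ) (N : ℕ) (f : F2 w) :
    partialEval w z N f = partialSum f.series (fun α => FreeMonoid.lift z α) N := by
  simp [partialEval, partialSum, mul_comm]

theorem sum_words_eq {E : Type*} [AddCommMonoid E] (N : ℕ) (g : Word n → E) (s : Finset (Word n))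
    (hs : ∀ α ∈ s, α.length < N) (hg : ∀ α, α ∉ s → g α = 0) :
    ∑ k ∈ Finset.range N, ∑ α ∈ words n k, g α = ∑ α ∈ s, g α := by
  rw [← Finset.sum_biUnion]
  · symm
    refine Finset.sum_subset (fun α hα => ?_) fun α _ hα => hg α hα
    rw [Finset.mem_biUnion]
    exact ⟨_, Finset.mem_range.2 (hs α hα), mem_words.2 rfl⟩
  · intro k _ l _ hkl
    refine Finset.disjoint_left.2 fun α hk hl => hkl ?_
    rw [← mem_words.1 hk, ← mem_words.1 hl]

/-- By Banach–Steinhaus the pointwise limit of the functionals `partialEval` is bounded. On `Z_α`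
they equal `λ_α` as soon as `N > |α|`, so the limit extends evaluation. -/
theorem mem_boundedPointEvals_of_tendsto {z : Fin n → ℂ}
    (h : ∀ f : F2 w, ∃ s : ℂ,
      Tendsto (partialSum f.series fun α => FreeMonoid.lift z α) atTop (𝓝 s)) :
    z ∈ boundedPointEvals w := by
  choose s hs using h
  have ht : Tendsto (fun N f => partialEval w z N f) atTop (𝓝 s) := by
    rw [tendsto_pi_nhds]
    intro f
    simpa only [partialEval_apply] using hs f
  have hl : ∀ f, continuousLinearMapOfTendsto (partialEval w z) ht f = s f := fun _ => rfl
  refine mem_of_extendsEval w (l := continuousLinearMapOfTendsto (partialEval w z) ht)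
    ((extendsEval_iff w z _).2 fun α => ?_)
  rw [hl]
  refine tendsto_nhds_unique (hs _) (tendsto_const_nhds.congr' ?_)
  filter_upwards [eventually_gt_atTop α.length] with N hN
  rw [partialSum, sum_words_eq N _ {α}]
  · simp [F2.Z_series, monomial]
  · simpa using hN
  · intro β hβ
    rw [Finset.mem_singleton] at hβ
    simp [F2.Z_series, monomial, hβ]

end

end WeightedFock

namespace WeightedFock

noncomputable section

variable {n : ℕ} (w : Weights n)

/-! ### Dilated shifts transported to `H` -/

theorem lift_LZ_Z (α β : Word n) : FreeMonoid.lift (LZ w) α (F2.Z w β) = F2.Z w (α * β) := by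
  induction α using FreeMonoid.inductionOn' with
  | one => simp
  | of_mul i α ih =>
    rw [map_mul, FreeMonoid.lift_eval_of, mul_apply_eq_comp, ih, LZ_Z, mul_assoc]

/-- Positivity makes `r ‖L_Z‖ < ‖L_Z‖` strict for `r < 1`. If `∑ L_{Z_j} L_{Z_j}* = 0`, pairing with
`x = Z_{g_i}` forces `L_{Z_i}* x = 0`, although `⟨L_{Z_i}* x, 1⟩ = ‖Z_{g_i}‖² ≠ 0`. -/
theorem rowNorm_LZ_pos (hn : 1 ≤ n) : 0 < rowNorm (LZ w) := by
  refine Real.sqrt_pos.2 (norm_pos_iff.2 fun h => ?_)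
  let i : Fin n := ⟨0, hn⟩
  set x : F2 w := F2.Z w (FreeMonoid.of i) with hx
  have h1 : ∑ j, ‖ContinuousLinearMap.adjoint (LZ w j) x‖ ^ 2 = 0 := by
    have h2 := congrArg (fun T : F2 w →L[ℂ] F2 w => inner ℂ x (T x)) h
    simp only [sum_apply, mul_apply_eq_comp, inner_sum, zero_apply, inner_zero_right,
      ← ContinuousLinearMap.adjoint_inner_left, inner_self_eq_norm_sq_to_K] at h2
    exact (RCLike.ofReal_eq_zero (K := ℂ)).1 (by push_cast; exact h2)
  have h3 := (Finset.sum_eq_zero_iff_of_nonneg fun j _ => by positivity).1 h1 i (Finset.mem_univ i)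
  have h4 : ContinuousLinearMap.adjoint (LZ w i) x = 0 := by simpa using h3
  have h5 : inner ℂ (ContinuousLinearMap.adjoint (LZ w i) x) (F2.Z w 1) = 0 := by simp [h4]
  rw [ContinuousLinearMap.adjoint_inner_left, LZ_Z, mul_one, F2.inner_Z, F2.Z_series] at h5
  simp [monomial, w.mon_ne_zero] at h5

/-- There are countably many words, so they inject into any infinite Hilbert basis of `H`;
separability of `H` plays no role. -/
theorem exists_isometry (H : Type*) [NormedAddCommGroup H] [InnerProductSpace ℂ H]
    [CompleteSpace H] (hH : ¬ FiniteDimensional ℂ H) : Nonempty (F2 w →ₗᵢ[ℂ] H) := by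
  obtain ⟨s, b, -⟩ := exists_hilbertBasis ℂ H
  have hs : Infinite s := by
    by_contra hfin
    have : Finite s := not_infinite_iff_finite.1 hfin
    have := Fintype.ofFinite s
    exact hH (b.toOrthonormalBasis.toBasis.finiteDimensional_of_finite)
  have : Countable (Word n) := inferInstanceAs (Countable (List (Fin n)))
  obtain ⟨e, he⟩ := exists_injective_nat (Word n)
  let f : ℕ ↪ s := Infinite.natEmbedding s
  have ho : Orthonormal ℂ fun α : Word n => b (f (e α)) :=
    b.orthonormal.comp _ (f.injective.comp he)
  exact ⟨ho.orthogonalFamily.linearIsometry.comp (toL2Isometry w).toLinearIsometry⟩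

section Dilation

variable {w} {H : Type*} [NormedAddCommGroup H] [InnerProductSpace ℂ H] [CompleteSpace H]

/-- The tuple `r L_Z` transported to `H` by an isometry. -/
def dilatedShift (V : F2 w →ₗᵢ[ℂ] H) (r : ℂ) (i : Fin n) : H →L[ℂ] H :=
  V.toContinuousLinearMap ∘L (r • LZ w i) ∘L
    ContinuousLinearMap.adjoint V.toContinuousLinearMap

theorem adjoint_isometry_apply (V : F2 w →ₗᵢ[ℂ] H) (x : F2 w) :
    ContinuousLinearMap.adjoint V.toContinuousLinearMap (V x) = x := by
  refine ext_inner_left ℂ fun v => ?_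
  rw [ContinuousLinearMap.adjoint_inner_right]
  exact V.inner_map_map v x

theorem norm_conj_isometry_le (V : F2 w →ₗᵢ[ℂ] H) (T : F2 w →L[ℂ] F2 w) :
    ‖V.toContinuousLinearMap ∘L T ∘L ContinuousLinearMap.adjoint V.toContinuousLinearMap‖ ≤
      ‖T‖ := by
  have h := V.norm_toContinuousLinearMap_le
  have h' : ‖ContinuousLinearMap.adjoint V.toContinuousLinearMap‖ ≤ 1 := by
    rwa [LinearIsometryEquiv.norm_map]
  calc _ ≤ ‖V.toContinuousLinearMap‖ * (‖T‖ *
        ‖ContinuousLinearMap.adjoint V.toContinuousLinearMap‖) :=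
        (ContinuousLinearMap.opNorm_comp_le _ _).trans
          (by gcongr; exact ContinuousLinearMap.opNorm_comp_le _ _)
    _ ≤ 1 * (‖T‖ * 1) := by gcongr
    _ = ‖T‖ := by ring

theorem norm_compress_isometry_le (V : F2 w →ₗᵢ[ℂ] H) (T : H →L[ℂ] H) :
    ‖ContinuousLinearMap.adjoint V.toContinuousLinearMap ∘L T ∘L V.toContinuousLinearMap‖ ≤
      ‖T‖ := by
  have h := V.norm_toContinuousLinearMap_le
  have h' : ‖ContinuousLinearMap.adjoint V.toContinuousLinearMap‖ ≤ 1 := by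
    rwa [LinearIsometryEquiv.norm_map]
  calc _ ≤ ‖ContinuousLinearMap.adjoint V.toContinuousLinearMap‖ * (‖T‖ *
        ‖V.toContinuousLinearMap‖) :=
        (ContinuousLinearMap.opNorm_comp_le _ _).trans
          (by gcongr; exact ContinuousLinearMap.opNorm_comp_le _ _)
    _ ≤ 1 * (‖T‖ * 1) := by gcongr
    _ = ‖T‖ := by ring

theorem dilatedShift_mul_adjoint (V : F2 w →ₗᵢ[ℂ] H) (r : ℂ) (i : Fin n) :
    dilatedShift V r i * ContinuousLinearMap.adjoint (dilatedShift V r i) =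
      V.toContinuousLinearMap ∘L
        ((r * starRingEnd ℂ r) • (LZ w i * ContinuousLinearMap.adjoint (LZ w i))) ∘L
        ContinuousLinearMap.adjoint V.toContinuousLinearMap := by
  have h : ContinuousLinearMap.adjoint (dilatedShift V r i) = V.toContinuousLinearMap ∘L
      (starRingEnd ℂ r • ContinuousLinearMap.adjoint (LZ w i)) ∘L
        ContinuousLinearMap.adjoint V.toContinuousLinearMap := by
    rw [dilatedShift, ContinuousLinearMap.adjoint_comp, ContinuousLinearMap.adjoint_comp,
      ContinuousLinearMap.adjoint_adjoint, map_smulₛₗ, ContinuousLinearMap.comp_assoc]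
  ext x
  rw [h]
  simp [dilatedShift, adjoint_isometry_apply, smul_smul, mul_comm]

theorem rowNorm_dilatedShift_le (V : F2 w →ₗᵢ[ℂ] H) (r : ℂ) :
    rowNorm (dilatedShift V r) ≤ ‖r‖ * rowNorm (LZ w) := by
  have h : ∑ i, dilatedShift V r i * ContinuousLinearMap.adjoint (dilatedShift V r i) =
      V.toContinuousLinearMap ∘L
        ((r * starRingEnd ℂ r) • ∑ i, LZ w i * ContinuousLinearMap.adjoint (LZ w i)) ∘L
        ContinuousLinearMap.adjoint V.toContinuousLinearMap := by
    simp only [dilatedShift_mul_adjoint]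
    ext x
    simp [Finset.smul_sum]
  rw [rowNorm, rowNorm, h, ← Real.sqrt_sq (norm_nonneg r), ← Real.sqrt_mul (sq_nonneg _)]
  refine Real.sqrt_le_sqrt ((norm_conj_isometry_le V _).trans_eq ?_)
  rw [norm_smul, norm_mul, RCLike.norm_conj, sq]

/-- Since `V* V = 1`, the inner factors in a product of dilated shifts cancel, and each letter
contributes one `r`. -/
theorem lift_dilatedShift (V : F2 w →ₗᵢ[ℂ] H) (r : ℂ) (α : Word n) (x : F2 w) :
    FreeMonoid.lift (dilatedShift V r) α (V x) =
      V (r ^ α.length • FreeMonoid.lift (LZ w) α x) := by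
  induction α using FreeMonoid.inductionOn' with
  | one => simp
  | of_mul i α ih =>
    rw [map_mul, map_mul, mul_apply_eq_comp, ih, FreeMonoid.lift_eval_of,
      FreeMonoid.lift_eval_of, dilatedShift]
    simp [adjoint_isometry_apply, smul_smul, pow_add, mul_comm]

end Dilation

/-! ### Multipliers and the limit `r → 1` -/

/-- The coefficient at `Z_γ` of the product `φ ζ`, as a bounded functional of `ζ`. -/
def mulCoeffL (φ : Series n) (γ : Word n) : F2 w →L[ℂ] ℂ :=
  ∑ p ∈ splits γ, φ p.1 • F2.coeffL w p.2

theorem mulCoeffL_apply (φ : Series n) (γ : Word n) (ζ : F2 w) :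
    mulCoeffL w φ γ ζ = mulSeries φ ζ.series γ := by
  simp [mulCoeffL, mulSeries]

theorem monomial_mul_left (α β γ : Word n) : monomial (α * β) (α * γ) = monomial β γ := by
  simp [monomial, Pi.single_apply]

/-- Only left factors `α` of `γ` contribute; they have length at most `|γ| < N`, and each determines
its cofactor by cancellation. -/
theorem partialSum_monomial_mul (c : Series n) (β γ : Word n) {N : ℕ} (hN : γ.length < N) :
    partialSum c (fun α => monomial (α * β) γ) N = mulSeries c (monomial β) γ := by
  rw [partialSum, sum_words_eq N _ ((splits γ).image Prod.fst), Finset.sum_image]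
  · refine Finset.sum_congr rfl fun p hp => ?_
    rw [← mem_splits.1 hp, monomial_mul_left, smul_eq_mul]
  · intro p hp q hq hpq
    have h := (mem_splits.1 hp).trans (mem_splits.1 hq).symm
    rw [hpq] at h
    exact Prod.ext hpq (mul_left_cancel h)
  · intro α hα
    obtain ⟨p, hp, rfl⟩ := Finset.mem_image.1 hα
    have := congrArg FreeMonoid.length (mem_splits.1 hp)
    rw [FreeMonoid.length_mul] at this
    omega
  · intro α hα
    have : γ ≠ α * β := by
      rintro rfl
      exact hα (Finset.mem_image.2 ⟨(α, β), mem_splits.2 rfl, rfl⟩)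
    simp [monomial, this]

theorem exists_dilated_multiplier {H : Type*} [NormedAddCommGroup H] [InnerProductSpace ℂ H]
    [CompleteSpace H] (V : F2 w →ₗᵢ[ℂ] H) {φ : Series n} {r : ℂ} {M : ℝ} {Y : H →L[ℂ] H}
    (hY : Tendsto (partialSum φ fun α => FreeMonoid.lift (dilatedShift V r) α) atTop (𝓝 Y))
    (hM : ‖Y‖ ≤ M) :
    ∃ A : F2 w →L[ℂ] F2 w, ‖A‖ ≤ M ∧
      ∀ ζ : F2 w, (A ζ).series = mulSeries (fun α => φ α * r ^ α.length) ζ.series := by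
  set W := ContinuousLinearMap.adjoint V.toContinuousLinearMap with hW
  set A : F2 w →L[ℂ] F2 w := W ∘L Y ∘L V.toContinuousLinearMap with hA
  refine ⟨A, (norm_compress_isometry_le V Y).trans hM, fun ζ => ?_⟩
  ext γ
  rw [← mulCoeffL_apply, ← F2.coeffL_apply, ← ContinuousLinearMap.comp_apply]
  -- Both sides are bounded functionals of `ζ`, so monomials suffice; on `Z_β` the partial sums are
  -- constant once `N > |γ|`.
  congr 1
  refine F2.clm_ext w fun β => ?_
  have h1 : Tendsto (fun N => F2.coeffL w γ (W
      (partialSum φ (fun α => FreeMonoid.lift (dilatedShift V r) α) N (V (F2.Z w β))))) atTop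
      (𝓝 (F2.coeffL w γ (W (Y (V (F2.Z w β)))))) :=
    ((F2.coeffL w γ ∘L W).continuous.tendsto _).comp
      (((ContinuousLinearMap.apply ℂ H (V (F2.Z w β))).continuous.tendsto Y).comp hY)
  refine tendsto_nhds_unique h1 (tendsto_const_nhds.congr' ?_)
  filter_upwards [eventually_gt_atTop γ.length] with N hN
  rw [mulCoeffL_apply, F2.Z_series, ← partialSum_monomial_mul _ _ _ hN]
  simp only [partialSum, sum_apply, map_sum, smul_apply, map_smul, lift_dilatedShift, lift_LZ_Z]
  simp [hW, adjoint_isometry_apply, F2.Z_series, mul_assoc]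

/-- A Fatou argument: over a finite set `s` the left side is continuous in `r`, so the bound for `r
< 1` passes to `r = 1` without any convergence of the operators `A`. -/
theorem sum_mulSeries_le {φ : Series n} {M : ℝ} (ζ : F2 w)
    (h : ∀ r : ℝ, 0 < r → r < 1 → ∃ A : F2 w →L[ℂ] F2 w, ‖A‖ ≤ M ∧
      ∀ ζ : F2 w, (A ζ).series = mulSeries (fun α => φ α * (r : ℂ) ^ α.length) ζ.series)
    (s : Finset (Word n)) :
    ∑ γ ∈ s, w.mon γ ^ 2 * ‖mulSeries φ ζ.series γ‖ ^ 2 ≤ (M * ‖ζ‖) ^ 2 := by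
  have hc : Continuous fun r : ℝ => ∑ γ ∈ s, w.mon γ ^ 2 *
      ‖mulSeries (fun α => φ α * (r : ℂ) ^ α.length) ζ.series γ‖ ^ 2 := by
    unfold mulSeries
    fun_prop
  have ht := (hc.tendsto 1).mono_left (nhdsWithin_le_nhds (s := Set.Iio 1))
  simp only [Complex.ofReal_one, one_pow, mul_one] at ht
  refine le_of_tendsto ht ?_
  filter_upwards [Ioo_mem_nhdsLT (zero_lt_one' ℝ)] with r hr
  obtain ⟨A, hA, hser⟩ := h r hr.1 hr.2
  rw [← hser ζ]
  calc _ ≤ ∑' γ, w.mon γ ^ 2 * ‖(A ζ).series γ‖ ^ 2 :=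
        (A ζ).summable.sum_le_tsum s fun γ _ => by positivity
    _ = ‖A ζ‖ ^ 2 := (F2.norm_sq w _).symm
    _ ≤ _ := by
      gcongr
      exact (A.le_opNorm ζ).trans (by gcongr)

theorem mulSeries_add (φ a b : Series n) :
    mulSeries φ (a + b) = mulSeries φ a + mulSeries φ b := by
  ext γ; simp [mulSeries, mul_add, Finset.sum_add_distrib]

theorem mulSeries_smul (φ : Series n) (r : ℂ) (a : Series n) :
    mulSeries φ (r • a) = r • mulSeries φ a := by
  ext γ; simp [mulSeries, Finset.mul_sum, mul_left_comm]

theorem exists_multiplier {φ : Series n} {M : ℝ} (hM : 0 ≤ M)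
    (h : ∀ (ζ : F2 w) (s : Finset (Word n)),
      ∑ γ ∈ s, w.mon γ ^ 2 * ‖mulSeries φ ζ.series γ‖ ^ 2 ≤ (M * ‖ζ‖) ^ 2) :
    ∃ L : F2 w →L[ℂ] F2 w, ‖L‖ ≤ M ∧ ∀ ζ : F2 w, (L ζ).series = mulSeries φ ζ.series := by
  have hmem (ζ : F2 w) : mulSeries φ ζ.series ∈ hardySubmodule w :=
    (mem_hardySubmodule w _).2 (summable_of_sum_le (fun γ => by positivity) (h ζ))
  let T : F2 w →ₗ[ℂ] F2 w :=
    { toFun := fun ζ => F2.mk (mulSeries φ ζ.series) (hmem ζ)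
      map_add' := fun f g => F2.ext (mulSeries_add φ _ _)
      map_smul' := fun r f => F2.ext (mulSeries_smul φ r _) }
  have hT : ∀ ζ, ‖T ζ‖ ≤ M * ‖ζ‖ := by
    intro ζ
    refine le_of_sq_le_sq ?_ (by positivity)
    rw [F2.norm_sq]
    exact (F2.mk _ (hmem ζ)).summable.tsum_le_of_sum_le (h ζ)
  exact ⟨T.mkContinuous M hT, T.mkContinuous_norm_le hM hT, fun ζ => rfl⟩

theorem mulSeries_monomial_mul (φ : Series n) (α β : Word n) :
    mulSeries φ (monomial β) (α * β) = φ α := by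
  rw [mulSeries, Finset.sum_eq_single (α, β)]
  · simp [monomial]
  · intro p hp hne
    have : p.2 ≠ β := by
      intro h2
      have h := mem_splits.1 hp
      rw [h2] at h
      exact hne (Prod.ext (mul_right_cancel h) h2)
    simp [monomial, this]
  · intro h
    exact absurd ((mem_splits (p := (α, β))).2 rfl) h

theorem mulSeries_monomial_eq_zero (φ : Series n) {β γ : Word n}
    (h : γ ∉ Set.range fun α => α * β) : mulSeries φ (monomial β) γ = 0 := by
  refine Finset.sum_eq_zero fun p hp => ?_
  have : p.2 ≠ β := by
    rintro rfl
    exact h ⟨p.1, mem_splits.1 hp⟩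
  simp [monomial, this]

/-- On `Z_β` the series is `∑ φ_α Z_{αβ}`, which is the basis expansion of `φ Z_β` without the
vanishing terms at words not ending in `β`. -/
theorem isSeriesOfShift_of_multiplier {φ : Series n} {L : F2 w →L[ℂ] F2 w}
    (hL : ∀ ζ : F2 w, (L ζ).series = mulSeries φ ζ.series) : IsSeriesOfShift w φ L := by
  intro p
  induction p using MonoidAlgebra.induction_linear with
  | zero => simp [ofPoly_zero, hasSum_zero]
  | add p q hp hq => simpa only [ofPoly_add, map_add, smul_add] using hp.add hq
  | single β r =>
    simp only [ofPoly_single, map_smul, lift_LZ_Z]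
    have h := F2.hasSum_Z w (L (F2.Z w β))
    rw [hL, F2.Z_series] at h
    have hinj : Function.Injective fun α : Word n => α * β := fun _ _ h => mul_right_cancel h
    have h2 := (hinj.hasSum_iff fun γ hγ => by
      rw [mulSeries_monomial_eq_zero φ hγ, zero_smul]).2 h
    simp only [Function.comp_def, mulSeries_monomial_mul] at h2
    simpa only [smul_comm r] using h2.const_smul r

theorem isSeriesOfShift_iff {φ : Series n} {L : F2 w →L[ℂ] F2 w}
    (hL : ∀ ζ : F2 w, (L ζ).series = mulSeries φ ζ.series) (A : F2 w →L[ℂ] F2 w) :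
    IsSeriesOfShift w φ A ↔ A = L := by
  refine ⟨fun h => F2.clm_ext w fun α => ?_, ?_⟩
  · exact (h _).unique (isSeriesOfShift_of_multiplier w hL _)
  · rintro rfl
    exact isSeriesOfShift_of_multiplier w hL

theorem multiplier_of_isBoundedFreeHolomorphic (hn : 1 ≤ n) {H : Type*} [NormedAddCommGroup H]
    [InnerProductSpace ℂ H] [CompleteSpace H] (hH : ¬ FiniteDimensional ℂ H) {φ : Series n}
    (hφ : IsBoundedFreeHolomorphic H (rowNorm (LZ w)) φ) :
    ∃ L : F2 w →L[ℂ] F2 w,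
      ‖L‖ ≤ sSup ((fun X => ‖evalOp φ X‖) '' opBall n H (rowNorm (LZ w))) ∧
      ∀ ζ : F2 w, (L ζ).series = mulSeries φ ζ.series := by
  obtain ⟨hol, B, hB⟩ := hφ
  obtain ⟨V⟩ := exists_isometry w H hH
  refine exists_multiplier w (Real.sSup_nonneg ?_) fun ζ s => sum_mulSeries_le w ζ ?_ s
  · rintro _ ⟨X, -, rfl⟩
    exact norm_nonneg _
  · intro r h0 h1
    have hX : dilatedShift V (r : ℂ) ∈ opBall n H (rowNorm (LZ w)) :=
      (rowNorm_dilatedShift_le V r).trans_lt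
        (mul_lt_of_lt_one_left (rowNorm_LZ_pos w hn) (by simpa [abs_of_pos h0] using h1))
    -- Boundedness of `φ` makes `sSup` a genuine upper bound.
    exact exists_dilated_multiplier w V (tendsto_nhds_limUnder (hol _ hX))
      (le_csSup ⟨B, by rintro _ ⟨X, hX, rfl⟩; exact hB X hX⟩ ⟨_, hX, rfl⟩)

end

end WeightedFock

theorem theorem4p2 (n : ℕ) (hn : 1 ≤ n) (w : Weights n) :
    (boundedPointEvals w =
        {z : Fin n → ℂ | Summable fun α : Word n => ‖FreeMonoid.lift z α‖ ^ 2 / w.mon α ^ 2} ∧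
      {z : Fin n → ℂ | Summable fun α : Word n => ‖FreeMonoid.lift z α‖ ^ 2 / w.mon α ^ 2} =
        jointPointSpectrum fun i => ContinuousLinearMap.adjoint (LZ w i)) ∧
    (∀ z ∈ boundedPointEvals w, ∃ ℓ : F2 w →L[ℂ] ℂ,
      (∀ ℓ' : F2 w →L[ℂ] ℂ, ExtendsEval w z ℓ' ↔ ℓ' = ℓ) ∧
      ∀ f : F2 w,
        (Summable fun α => ‖f.series α * FreeMonoid.lift z α‖) ∧
        HasSum (fun α => f.series α * FreeMonoid.lift z α) (ℓ f) ∧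
        ‖∑' α, f.series α * FreeMonoid.lift z α‖ ≤
          ‖f‖ * √(∑' α : Word n, ‖FreeMonoid.lift z α‖ ^ 2 / w.mon α ^ 2)) ∧
    (∀ z : Fin n → ℂ,
      (∀ f : F2 w, ∃ s : ℂ,
        Tendsto (partialSum f.series fun α => FreeMonoid.lift z α) atTop (𝓝 s)) →
      z ∈ boundedPointEvals w) ∧
    (∀ (H : Type*) [NormedAddCommGroup H] [InnerProductSpace ℂ H] [CompleteSpace H],
      ¬ FiniteDimensional ℂ H → ∀ φ : Series n, IsBoundedFreeHolomorphic H (rowNorm (LZ w)) φ →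
        IsLeftMultiplier w φ ∧
        ∃ Lφ φL : F2 w →L[ℂ] F2 w,
          (∀ ζ : F2 w, (Lφ ζ).series = mulSeries φ ζ.series) ∧
          (∀ A : F2 w →L[ℂ] F2 w, IsSeriesOfShift w φ A ↔ A = φL) ∧
          ‖Lφ‖ = ‖φL‖ ∧
          ‖φL‖ ≤ sSup ((fun X => ‖evalOp φ X‖) '' opBall n H (rowNorm (LZ w)))) := by
  refine ⟨⟨boundedPointEvals_eq w, jointPointSpectrum_eq w⟩,
    fun z hz => exists_unique_extension w hz, fun z => mem_boundedPointEvals_of_tendsto w, ?_⟩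
  intro H _ _ _ hH φ hφ
  obtain ⟨L, hnorm, hL⟩ := multiplier_of_isBoundedFreeHolomorphic w hn hH hφ
  -- The same `L` serves as `L_φ` and as `φ(L_Z)`, so their norms agree trivially.
  exact ⟨fun ζ => hL ζ ▸ (L ζ).summable, L, L, hL, isSeriesOfShift_iff w hL, rfl, hnorm⟩
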